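/- For a finite simple graph $G$ with adjacency matrix $A(G)$ and diagonal degree matrix $D(G)$ and for $\alpha\in[0,1]$, let $A_\alpha(G)=A(G)+\alpha\,(D(G)-A(G))$ and let $\rho_\alpha(G)$ be the largest eigenvalue of $A_\alpha(G)$. A real number $\lambda$ is an *$A_\alpha$-limit point* if there is a sequence of graphs $(G_k)$ whose numbers $\rho_\alpha(G_k)$ are pairwise distinct and converge to $\lambda$. For $\lambda>2$ and $0\le\alpha<1$ put $$\delta_\alpha=\alpha+\frac{(1-\alpha)^2}{\lambda-\alpha},\qquad \theta'_\alpha=\frac{(2\alpha-\lambda)+\sqrt{(2\alpha-\lambda)^2-4(1-\alpha)^2}}{2},$$ $$F_0(\lambda,\alpha)=3\alpha-\lambda-\frac{(1-\alpha)^2}{\alpha-\lambda}-2\theta'_\alpha,\qquad F_1(\lambda,\alpha)=(2\alpha-\lambda+\delta_\alpha)(\theta'_\alpha-\delta_\alpha)-2(1-\alpha)^2,$$ and let $\tau_0(\alpha)$ denote the unique solution $\lambda>2$ of $F_0(\lambda,\alpha)=0$. Let $\alpha^*=\frac{3-\sqrt2}{7}$. **Theorem.** 1. Let $0<\alpha<\alpha^*$.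 Then $\tau_0(\alpha)$ exists, the equation $(2\alpha-\lambda+\delta_\alpha)(\theta'_\alpha-\delta_\alpha)=2(1-\alpha)^2$ has exactly two solutions $\tau_1(\alpha)<\tau_1'(\alpha)$ in $(2,\infty)$, $\tau_1(\alpha)=\tau_0(\alpha)$, $F_1(\lambda,\alpha)<0$ for $\tau_1(\alpha)<\lambda<\tau_1'(\alpha)$, and every $\lambda\in[\tau_1(\alpha),\tau_1'(\alpha))$ is an $A_\alpha$-limit point. 2. Let $\alpha=0$. Then $\tau_0(0)=\sqrt{2+\sqrt5}$, this is the only zero of $F_1(\cdot,0)$ in $(2,\infty)$, $F_1(\lambda,0)<0$ for all $\lambda>\sqrt{2+\sqrt5}$, and every $\lambda\in[\sqrt{2+\sqrt5},\infty)$ is an $A_0$-limit point (so here $\tau_1(0)=\sqrt{2+\sqrt5}$ and $\tau_1'(0)=\infty$). 3. For $\alpha=\alpha^*$ the two solutions coincide: $\tau_0(\alpha^*)$ exists and is the only zero of $F_1(\cdot,\alpha^*)$ in $(2,\infty)$. 4. $\alpha^*$ is the largest $\beta\in(0,1]$ such that for every $0<\alpha<\beta$ the zeros of $F_1(\cdot,\alpha)$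 in $(2,\infty)$ are exactly two numbers $\tau_1(\alpha)<\tau_1'(\alpha)$ with $\tau_1(\alpha)=\tau_0(\alpha)$, and $F_1(\lambda,\alpha)<0$ for $\tau_1(\alpha)<\lambda<\tau_1'(\alpha)$. -/

import Mathlib

noncomputable section

/-! ### The matrix `A_α(G)`, its largest eigenvalue, and `A_α`-limit points -/

open Classical in
/-- `A_α(G) = A(G) + α (D(G) - A(G))` for a finite simple graph `G`, where `A(G)` is the adjacency
matrix and `D(G)` the diagonal matrix of vertex degrees. -/
def alphaMatrix {V : Type*} [Fintype V] (α : ℝ) (G : SimpleGraph V) : Matrix V V ℝ :=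
  G.adjMatrix ℝ + α • (G.degMatrix ℝ - G.adjMatrix ℝ)

open Classical in
/-- The largest eigenvalue of `A_α(G)`. For a nonempty vertex set the spectrum is a finite
nonempty set of reals (the matrix is symmetric), so the supremum is a maximum. -/
def alphaRadius {V : Type*} [Fintype V] (α : ℝ) (G : SimpleGraph V) : ℝ :=
  sSup (spectrum ℝ (alphaMatrix α G))

/-- `l` is an `A_α`-limit point: there is a sequence of finite nonempty graphs whose
`A_α`-spectral radii are pairwise distinct and converge to `l`. -/
def IsAlphaLimitPoint (α l : ℝ) : Prop :=
  ∃ (n : ℕ → ℕ) (G : ∀ k, SimpleGraph (Fin (n k + 1))),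
    Function.Injective (fun k => alphaRadius α (G k)) ∧
      Filter.Tendsto (fun k => alphaRadius α (G k)) Filter.atTop (nhds l)

/-! ### The equations that define `τ₀`, `τ₁`, `τ₁'`

All of them are considered for `l > 2` and `0 ≤ α < 1` only; there
`(2α - l)² > 4(1 - α)²` and `l > α`. -/

/-- `δ_α = α + (1 - α)² / (l - α)`. -/
def deltaAlpha (α l : ℝ) : ℝ := α + (1 - α) ^ 2 / (l - α)

/-- `θ'_α = ((2α - l) + √((2α - l)² - 4(1 - α)²)) / 2`. -/
def thetaAlpha' (α l : ℝ) : ℝ :=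
  ((2 * α - l) + √((2 * α - l) ^ 2 - 4 * (1 - α) ^ 2)) / 2

/-- `F₀(l, α) = 3α - l - (1 - α)² / (α - l) - 2 θ'_α`. -/
def funF0 (α l : ℝ) : ℝ := 3 * α - l - (1 - α) ^ 2 / (α - l) - 2 * thetaAlpha' α l

/-- `F₁(l, α) = (2α - l + δ_α)(θ'_α - δ_α) - 2(1 - α)²`. -/
def funF1 (α l : ℝ) : ℝ :=
  (2 * α - l + deltaAlpha α l) * (thetaAlpha' α l - deltaAlpha α l) - 2 * (1 - α) ^ 2

/-- `t = τ₀(α)`: the only solution `l > 2` of `F₀(l, α) = 0` is `t`. -/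
def IsTau0 (α t : ℝ) : Prop := {l : ℝ | 2 < l ∧ funF0 α l = 0} = {t}

/-- `t = τ₁(α)` and `t' = τ₁'(α)`: `t < t'` are exactly the solutions `l > 2` of
`(2α - l + δ_α)(θ'_α - δ_α) = 2(1 - α)²`, and the smaller one is `τ₀(α)`. -/
def IsTau1Pair (α t t' : ℝ) : Prop :=
  IsTau0 α t ∧ t < t' ∧ {l : ℝ | 2 < l ∧ funF1 α l = 0} = {t, t'}

/-- `α* = (3 - √2) / 7`. -/
def alphaStar : ℝ := (3 - √2) / 7

end

/-! ### The equations in terms of `b` -/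

/-! Write β = 1 - α and b = -θ'. Then b is the smaller root of b² - (l - 2α)b + β² = 0, and l = 2α +
b + β²/b is a decreasing bijection from (0, β) onto (2, ∞). In this coordinate F₀ = b + δ - β²/b and
F₁ = (b - δ)F₀. Up to positive denominators, F₀ is a quartic in b that increases on b ≥ 0, and b - δ
is a cubic with at most one positive zero. So F₁ vanishes only at the quartic zero b₀, which gives
τ₀, and at the cubic zero b₁, which exists for 0 < α ≤ α* and gives τ₁'. At b = β/√2 both
polynomials contain the factor 1 - α(3 + √2), with opposite signs. Hence b₁ < b₀ below α*, and the
two zeros meet at α*.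

For the limit points, let l satisfy F₀ < 0 and F₁ ≤ 0. Eliminating along the spine of a caterpillar
gives pivots c₀ = l - α - r₀δ and cₙ₊₁ = l - 2α - rₙ₊₁δ - β²/cₙ, where rₙ counts leaves. A greedy
choice of rₙ keeps every pivot in [b, b + δ). The vector with xₙ₊₁ = (cₙ/β)xₙ on the spine then
satisfies the eigenvalue equation for l except for a deficit (cₙ + α)xₙ at the last spine vertex.
The deficit puts the largest eigenvalue strictly below l (`alphaRadius_lt_of_supersolution`). If xₙ
is the least of x₀, …, xₙ, the Rayleigh quotient is within (b + δ + α)/(n + 1) of l.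

It remains to find such record minima arbitrarily late, that is, to show that x always returns to or
below an earlier value (`exists_later_le`). F₀ < 0 prevents leafless stretches that start with a
pivot above β from lasting forever. F₁ ≤ 0 makes the descent after such a stretch mirror the ascent
(`pivots_reflection`). -/

/-- The parameter `l` as a function of `b`. -/
noncomputable def paramOfRoot (α b : ℝ) : ℝ := 2 * α + b + (1 - α) ^ 2 / b

/-- The numerator of `F₀` in terms of `b`. -/
noncomputable def quarticF0 (α b : ℝ) : ℝ :=
  (b ^ 2 + α * b) ^ 2 + (1 - α) ^ 2 * b ^ 2 - (1 - α) ^ 4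

/-- The numerator of `b - δ_α` in terms of `b`. -/
noncomputable def cubicDelta (α b : ℝ) : ℝ := b ^ 3 - α ^ 2 * b - α * (1 - α) ^ 2

theorem negTheta_spec {α l : ℝ} (h1 : α < 1) (hl : 2 < l) :
    0 < -thetaAlpha' α l ∧ -thetaAlpha' α l < 1 - α ∧
      (-thetaAlpha' α l) ^ 2 + (1 - α) ^ 2 = (l - 2 * α) * (-thetaAlpha' α l) := by
  have hD : 0 ≤ (2 * α - l) ^ 2 - 4 * (1 - α) ^ 2 := by nlinarith
  have hs := Real.sq_sqrt hD
  have hs0 := Real.sqrt_nonneg ((2 * α - l) ^ 2 - 4 * (1 - α) ^ 2)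
  unfold thetaAlpha'
  set s := √((2 * α - l) ^ 2 - 4 * (1 - α) ^ 2)
  refine ⟨?_, ?_, by nlinarith⟩
  · have : s < l - 2 * α := by
      apply lt_of_pow_lt_pow_left₀ 2 (by linarith)
      nlinarith [mul_pos (sub_pos.2 h1) (sub_pos.2 h1)]
    linarith
  · have : l - 2 < s := by
      apply lt_of_pow_lt_pow_left₀ 2 hs0
      rw [hs]
      -- The discriminant minus (l - 2)² equals 4(1 - α)(l - 2).
      nlinarith [mul_pos (sub_pos.2 h1) (sub_pos.2 hl)]
    linarith

theorem paramOfRoot_gt_two {α b : ℝ} (hb : 0 < b) (hb1 : b < 1 - α) : 2 < paramOfRoot α b := by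
  have : 2 * (1 - α) - b < (1 - α) ^ 2 / b := by
    rw [lt_div_iff₀ hb]
    nlinarith [mul_pos (sub_pos.2 hb1) (sub_pos.2 hb1)]
  unfold paramOfRoot
  linarith

theorem paramOfRoot_negTheta {α l : ℝ} (h1 : α < 1) (hl : 2 < l) :
    paramOfRoot α (-thetaAlpha' α l) = l := by
  obtain ⟨hb, -, h⟩ := negTheta_spec h1 hl
  unfold paramOfRoot
  rw [eq_comm, ← sub_eq_iff_eq_add', eq_div_iff hb.ne']
  linarith

theorem paramOfRoot_strictAnti {α b b' : ℝ} (hb : 0 < b) (hbb : b < b') (hb' : b' < 1 - α) :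
    paramOfRoot α b' < paramOfRoot α b := by
  have hb0 : 0 < b' := hb.trans hbb
  have h : paramOfRoot α b - paramOfRoot α b'
      = (b' - b) * ((1 - α) ^ 2 - b * b') / (b * b') := by
    unfold paramOfRoot
    field_simp
    ring
  have : 0 < paramOfRoot α b - paramOfRoot α b' := by
    rw [h]
    apply div_pos (mul_pos (sub_pos.2 hbb) _) (mul_pos hb hb0)
    nlinarith
  linarith

theorem negTheta_paramOfRoot {α b : ℝ} (hb : 0 < b) (hb1 : b < 1 - α) :
    -thetaAlpha' α (paramOfRoot α b) = b := by
  have h1 : α < 1 := by linarith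
  have hl := paramOfRoot_gt_two hb hb1
  obtain ⟨h0, h2, -⟩ := negTheta_spec h1 hl
  have h := paramOfRoot_negTheta h1 hl
  rcases lt_trichotomy (-thetaAlpha' α (paramOfRoot α b)) b with hlt | heq | hgt
  · have := paramOfRoot_strictAnti h0 hlt hb1
    linarith
  · exact heq
  · have := paramOfRoot_strictAnti hb hgt h2
    linarith

theorem deltaAlpha_pos {α l : ℝ} (h0 : 0 ≤ α) (h1 : α < 1) (hl : 2 < l) :
    0 < deltaAlpha α l := by
  have : 0 < (1 - α) ^ 2 / (l - α) := div_pos (pow_pos (by linarith) 2) (by linarith)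
  unfold deltaAlpha
  linarith

theorem funF0_eq {α l : ℝ} (h1 : α < 1) (hl : 2 < l) :
    funF0 α l = deltaAlpha α l + -thetaAlpha' α l - (1 - α) ^ 2 / (-thetaAlpha' α l) := by
  have h := paramOfRoot_negTheta h1 hl
  unfold paramOfRoot at h
  have h2 : (1 - α) ^ 2 / (α - l) = -((1 - α) ^ 2 / (l - α)) := by
    rw [← neg_sub l α, div_neg]
  unfold funF0 deltaAlpha
  rw [h2]
  linarith

/-- This factorization explains why τ₀ is a zero of F₁: substituting l - 2α = b + β²/b turns F₁ into
(b + β²/b - δ)(b + δ) - 2β² = (b - δ)(b + δ - β²/b). -/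
theorem funF1_eq {α l : ℝ} (h1 : α < 1) (hl : 2 < l) :
    funF1 α l = (-thetaAlpha' α l - deltaAlpha α l) * funF0 α l := by
  obtain ⟨hb, -, h⟩ := negTheta_spec h1 hl
  have h' := paramOfRoot_negTheta h1 hl
  rw [funF0_eq h1 hl]
  unfold paramOfRoot at h'
  unfold funF1
  generalize deltaAlpha α l = d
  rw [← neg_neg (thetaAlpha' α l)]
  generalize -thetaAlpha' α l = b at *
  rw [← h', neg_neg]
  field_simp
  ring

theorem root_denominator_pos {α b : ℝ} (h0 : 0 ≤ α) (h1 : α < 1) (hb : 0 < b) :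
    0 < b ^ 2 + α * b + (1 - α) ^ 2 := by
  have : 0 < 1 - α := by linarith
  positivity

theorem deltaAlpha_paramOfRoot {α b : ℝ} (h0 : 0 ≤ α) (h1 : α < 1) (hb : 0 < b) :
    deltaAlpha α (paramOfRoot α b) = α + (1 - α) ^ 2 * b / (b ^ 2 + α * b + (1 - α) ^ 2) := by
  have hp := root_denominator_pos h0 h1 hb
  have : paramOfRoot α b - α = (b ^ 2 + α * b + (1 - α) ^ 2) / b := by
    unfold paramOfRoot
    field_simp
    ring
  unfold deltaAlpha
  rw [this, div_div_eq_mul_div]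

theorem funF0_paramOfRoot {α b : ℝ} (h0 : 0 ≤ α) (hb : 0 < b) (hb1 : b < 1 - α) :
    funF0 α (paramOfRoot α b)
      = quarticF0 α b / (b * (b ^ 2 + α * b + (1 - α) ^ 2)) := by
  have h1 : α < 1 := by linarith
  have hp := root_denominator_pos h0 h1 hb
  rw [funF0_eq h1 (paramOfRoot_gt_two hb hb1), negTheta_paramOfRoot hb hb1,
    deltaAlpha_paramOfRoot h0 h1 hb]
  unfold quarticF0
  field_simp
  ring

theorem funF1_paramOfRoot {α b : ℝ} (h0 : 0 ≤ α) (hb : 0 < b) (hb1 : b < 1 - α) :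
    funF1 α (paramOfRoot α b)
      = cubicDelta α b * quarticF0 α b / (b * (b ^ 2 + α * b + (1 - α) ^ 2) ^ 2) := by
  have h1 : α < 1 := by linarith
  have hp := root_denominator_pos h0 h1 hb
  have hd : b - deltaAlpha α (paramOfRoot α b)
      = cubicDelta α b / (b ^ 2 + α * b + (1 - α) ^ 2) := by
    rw [deltaAlpha_paramOfRoot h0 h1 hb]
    unfold cubicDelta
    field_simp
    ring
  rw [funF1_eq h1 (paramOfRoot_gt_two hb hb1), negTheta_paramOfRoot hb hb1, hd,
    funF0_paramOfRoot h0 hb hb1, div_mul_div_comm]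
  congr 1
  ring

/-! ### Positive zeros of the quartic and the cubic. -/

theorem quarticF0_strictMono {α b b' : ℝ} (h0 : 0 ≤ α) (h1 : α < 1) (hb : 0 ≤ b)
    (hbb : b < b') : quarticF0 α b < quarticF0 α b' := by
  have hs : b ^ 2 < b' ^ 2 := pow_lt_pow_left₀ hbb hb two_ne_zero
  have h2 : (b ^ 2 + α * b) ^ 2 ≤ (b' ^ 2 + α * b') ^ 2 := by
    gcongr
  have h3 : (1 - α) ^ 2 * b ^ 2 < (1 - α) ^ 2 * b' ^ 2 :=
    mul_lt_mul_of_pos_left hs (pow_pos (by linarith) 2)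
  unfold quarticF0
  linarith

/-- The cubic itself need not be monotone, but its quotient by b, namely b² - α² - αβ²/b, increases
for b > 0. -/
theorem cubicDelta_pos_of_lt {α b b' : ℝ} (h0 : 0 ≤ α) (hb : 0 < b) (hbb : b < b')
    (h : cubicDelta α b = 0) : 0 < cubicDelta α b' := by
  have e : b * cubicDelta α b' = b' * cubicDelta α b
      + (b' - b) * (b * b' * (b' + b) + α * (1 - α) ^ 2) := by
    unfold cubicDelta
    ring
  have hb' : 0 < b' := hb.trans hbb
  have : 0 < b * cubicDelta α b' := by
    rw [e, h, mul_zero, zero_add]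
    have := sub_pos.2 hbb
    positivity
  exact pos_of_mul_pos_right this hb.le

theorem exists_quarticF0_root {α : ℝ} (h0 : 0 ≤ α) (h1 : α < 1) :
    ∃ b, 0 < b ∧ b < 1 - α ∧ quarticF0 α b = 0 := by
  have hβ : 0 < 1 - α := by linarith
  have hc : ContinuousOn (quarticF0 α) (Set.Icc 0 (1 - α)) := by
    unfold quarticF0
    fun_prop
  have hlo : quarticF0 α 0 < 0 := by
    have : 0 < (1 - α) ^ 4 := by positivity
    simpa [quarticF0] using this
  have hhi : 0 < quarticF0 α (1 - α) := by
    have : quarticF0 α (1 - α) = ((1 - α) ^ 2 + α * (1 - α)) ^ 2 := by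
      unfold quarticF0
      ring
    rw [this]
    positivity
  obtain ⟨b, hb, h⟩ := intermediate_value_Ioo hβ.le hc ⟨hlo, hhi⟩
  exact ⟨b, hb.1, hb.2, h⟩

theorem quarticF0_eq_zero_iff {α b b' : ℝ} (h0 : 0 ≤ α) (h1 : α < 1) (hb : 0 < b)
    (h : quarticF0 α b = 0) (hb' : 0 < b') : quarticF0 α b' = 0 ↔ b' = b := by
  refine ⟨fun h' => ?_, fun e => e ▸ h⟩
  rcases lt_trichotomy b' b with hlt | heq | hgt
  · linarith [quarticF0_strictMono h0 h1 hb'.le hlt]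
  · exact heq
  · linarith [quarticF0_strictMono h0 h1 hb.le hgt]

theorem cubicDelta_eq_zero_iff {α b b' : ℝ} (h0 : 0 ≤ α) (hb : 0 < b)
    (h : cubicDelta α b = 0) (hb' : 0 < b') : cubicDelta α b' = 0 ↔ b' = b := by
  refine ⟨fun h' => ?_, fun e => e ▸ h⟩
  rcases lt_trichotomy b' b with hlt | heq | hgt
  · linarith [cubicDelta_pos_of_lt h0 hb' hlt h']
  · exact heq
  · linarith [cubicDelta_pos_of_lt h0 hb hgt h]

/-! ### Transfer of zeros and signs from b to l. -/

theorem setOf_eq_image_paramOfRoot {α : ℝ} (h1 : α < 1) (p : ℝ → Prop) :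
    {l | 2 < l ∧ p l} = paramOfRoot α '' {b | (0 < b ∧ b < 1 - α) ∧ p (paramOfRoot α b)} := by
  ext l
  constructor
  · rintro ⟨hl, h⟩
    obtain ⟨hb, hb1, -⟩ := negTheta_spec h1 hl
    have e := paramOfRoot_negTheta h1 hl
    exact ⟨_, ⟨⟨hb, hb1⟩, by rwa [e]⟩, e⟩
  · rintro ⟨b, ⟨⟨hb, hb1⟩, h⟩, rfl⟩
    exact ⟨paramOfRoot_gt_two hb hb1, h⟩

theorem funF0_eq_zero_iff {α b : ℝ} (h0 : 0 ≤ α) (hb : 0 < b) (hb1 : b < 1 - α) :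
    funF0 α (paramOfRoot α b) = 0 ↔ quarticF0 α b = 0 := by
  have hp := root_denominator_pos h0 (by linarith) hb
  rw [funF0_paramOfRoot h0 hb hb1, div_eq_zero_iff, or_iff_left (by positivity)]

theorem funF1_eq_zero_iff {α b : ℝ} (h0 : 0 ≤ α) (hb : 0 < b) (hb1 : b < 1 - α) :
    funF1 α (paramOfRoot α b) = 0 ↔ cubicDelta α b = 0 ∨ quarticF0 α b = 0 := by
  have hp := root_denominator_pos h0 (by linarith) hb
  rw [funF1_paramOfRoot h0 hb hb1, div_eq_zero_iff, or_iff_left (by positivity), mul_eq_zero]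

theorem isTau0_paramOfRoot {α b : ℝ} (h0 : 0 ≤ α) (hb : 0 < b) (hb1 : b < 1 - α)
    (h : quarticF0 α b = 0) : IsTau0 α (paramOfRoot α b) := by
  have h1 : α < 1 := by linarith
  unfold IsTau0
  rw [setOf_eq_image_paramOfRoot h1, ← Set.image_singleton]
  congr 1
  ext b'
  constructor
  · rintro ⟨⟨hb', hb1'⟩, h'⟩
    exact (quarticF0_eq_zero_iff h0 h1 hb h hb').1 ((funF0_eq_zero_iff h0 hb' hb1').1 h')
  · rintro rfl
    exact ⟨⟨hb, hb1⟩, (funF0_eq_zero_iff h0 hb hb1).2 h⟩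

theorem setOf_funF1_eq_pair {α b₀ b₁ : ℝ} (h0 : 0 ≤ α) (hb₀ : 0 < b₀) (hb₀1 : b₀ < 1 - α)
    (hq : quarticF0 α b₀ = 0) (hb₁ : 0 < b₁) (hb₁1 : b₁ < 1 - α) (hc : cubicDelta α b₁ = 0) :
    {l | 2 < l ∧ funF1 α l = 0} = {paramOfRoot α b₀, paramOfRoot α b₁} := by
  have h1 : α < 1 := by linarith
  rw [setOf_eq_image_paramOfRoot h1, ← Set.image_pair]
  congr 1
  ext b'
  constructor
  · rintro ⟨⟨hb', hb1'⟩, h'⟩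
    rcases (funF1_eq_zero_iff h0 hb' hb1').1 h' with h' | h'
    · exact Or.inr ((cubicDelta_eq_zero_iff h0 hb₁ hc hb').1 h')
    · exact Or.inl ((quarticF0_eq_zero_iff h0 h1 hb₀ hq hb').1 h')
  · rintro (rfl | rfl)
    · exact ⟨⟨hb₀, hb₀1⟩, (funF1_eq_zero_iff h0 hb₀ hb₀1).2 (Or.inr hq)⟩
    · exact ⟨⟨hb₁, hb₁1⟩, (funF1_eq_zero_iff h0 hb₁ hb₁1).2 (Or.inl hc)⟩

theorem negTheta_lt_of_paramOfRoot_lt {α b l : ℝ} (hb : 0 < b) (hb1 : b < 1 - α)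
    (h : paramOfRoot α b < l) : -thetaAlpha' α l < b := by
  have h1 : α < 1 := by linarith
  have hl := (paramOfRoot_gt_two hb hb1).trans h
  obtain ⟨-, hc1, -⟩ := negTheta_spec h1 hl
  by_contra! hle
  rcases hle.eq_or_lt with heq | hlt
  · rw [heq, paramOfRoot_negTheta h1 hl] at h
    exact lt_irrefl _ h
  · have := paramOfRoot_strictAnti hb hlt hc1
    rw [paramOfRoot_negTheta h1 hl] at this
    linarith

theorem lt_negTheta_of_lt_paramOfRoot {α b l : ℝ} (hb : 0 < b) (hb1 : b < 1 - α) (hl : 2 < l)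
    (h : l < paramOfRoot α b) : b < -thetaAlpha' α l := by
  have h1 : α < 1 := by linarith
  obtain ⟨hc, -, -⟩ := negTheta_spec h1 hl
  by_contra! hle
  rcases hle.eq_or_lt with heq | hlt
  · rw [← heq, paramOfRoot_negTheta h1 hl] at h
    exact lt_irrefl _ h
  · have := paramOfRoot_strictAnti hc hlt hb1
    rw [paramOfRoot_negTheta h1 hl] at this
    linarith

theorem funF0_neg {α b l : ℝ} (h0 : 0 ≤ α) (hb : 0 < b) (hb1 : b < 1 - α)
    (hq : quarticF0 α b = 0) (h : paramOfRoot α b < l) : funF0 α l < 0 := by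
  have h1 : α < 1 := by linarith
  have hl := (paramOfRoot_gt_two hb hb1).trans h
  obtain ⟨hc, hc1, -⟩ := negTheta_spec h1 hl
  have hp := root_denominator_pos h0 h1 hc
  rw [← paramOfRoot_negTheta h1 hl, funF0_paramOfRoot h0 hc hc1]
  refine div_neg_of_neg_of_pos ?_ (mul_pos hc hp)
  rw [← hq]
  exact quarticF0_strictMono h0 h1 hc.le (negTheta_lt_of_paramOfRoot_lt hb hb1 h)

theorem deltaAlpha_lt_negTheta {α l : ℝ} (h0 : 0 ≤ α) (h1 : α < 1) (hl : 2 < l)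
    (h : 0 < cubicDelta α (-thetaAlpha' α l)) : deltaAlpha α l < -thetaAlpha' α l := by
  obtain ⟨hc, hc1, -⟩ := negTheta_spec h1 hl
  have hp := root_denominator_pos h0 h1 hc
  have hd := deltaAlpha_paramOfRoot h0 h1 hc
  rw [paramOfRoot_negTheta h1 hl] at hd
  rw [hd, ← lt_sub_iff_add_lt', div_lt_iff₀ hp]
  unfold cubicDelta at h
  linarith

theorem funF1_neg {α l : ℝ} (h0 : 0 ≤ α) (h1 : α < 1) (hl : 2 < l)
    (hc : 0 < cubicDelta α (-thetaAlpha' α l)) (h : funF0 α l < 0) : funF1 α l < 0 := by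
  rw [funF1_eq h1 hl]
  exact mul_neg_of_pos_of_neg (sub_pos.2 (deltaAlpha_lt_negTheta h0 h1 hl hc)) h

/-! ### The threshold α* and the case α = 0. -/

theorem alphaStar_eq : alphaStar * (3 + √2) = 1 := by
  have := Real.sq_sqrt (show (0 : ℝ) ≤ 2 by norm_num)
  unfold alphaStar
  linarith

theorem alphaStar_pos : 0 < alphaStar := by
  have := alphaStar_eq
  by_contra! h
  nlinarith [Real.sqrt_nonneg 2]

theorem alphaStar_lt_one : alphaStar < 1 := by
  unfold alphaStar
  linarith [Real.sqrt_nonneg 2]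

/-- At α* the common zero of the cubic and the quartic is β/√2. Evaluating there for every α
isolates the factor 1 - α(3 + √2), which is positive exactly for α < α*. -/
theorem cubicDelta_div_sqrt_two (α : ℝ) : cubicDelta α ((1 - α) / √2)
    = (1 - α) / (2 * √2) * ((1 - α * (3 + √2)) * (1 - α + (2 - √2) * α)) := by
  have := Real.sq_sqrt (show (0 : ℝ) ≤ 2 by norm_num)
  have hs : √2 ≠ 0 := by positivity
  unfold cubicDelta
  generalize √2 = s at *
  field_simp
  have h3 : s ^ 3 = 2 * s := by rw [pow_succ, this]
  have h4 : s ^ 4 = 4 := by rw [show s ^ 4 = (s ^ 2) ^ 2 by ring, this]; norm_num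
  ring_nf
  simp only [this, h3, h4]
  ring

/-- The factor 1 - α(3 + √2) reappears with a negative coefficient, so for 0 < α < α* the point β/√2
separates the two zeros. -/
theorem quarticF0_div_sqrt_two (α : ℝ) : quarticF0 α ((1 - α) / √2)
    = -((1 - α) ^ 2 * (√2 - 1) / 4) * ((1 - α * (3 + √2)) * ((1 + √2) * (1 - α) + √2 * α)) := by
  have := Real.sq_sqrt (show (0 : ℝ) ≤ 2 by norm_num)
  have hs : √2 ≠ 0 := by positivity
  unfold quarticF0
  generalize √2 = s at *
  field_simp
  have h3 : s ^ 3 = 2 * s := by rw [pow_succ, this]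
  have h4 : s ^ 4 = 4 := by rw [show s ^ 4 = (s ^ 2) ^ 2 by ring, this]; norm_num
  have h5 : s ^ 5 = 4 * s := by rw [pow_succ, h4]
  have h6 : s ^ 6 = 8 := by rw [show s ^ 6 = (s ^ 2) ^ 3 by ring, this]; norm_num
  have h7 : s ^ 7 = 8 * s := by rw [pow_succ, h6]
  ring_nf
  simp only [this, h4, h5, h6, h7]
  ring

theorem div_sqrt_two_pos {α : ℝ} (h1 : α < 1) : 0 < (1 - α) / √2 :=
  div_pos (by linarith) (by positivity)

theorem div_sqrt_two_lt {α : ℝ} (h1 : α < 1) : (1 - α) / √2 < 1 - α :=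
  div_lt_self (by linarith) (by rw [Real.lt_sqrt] <;> norm_num)

/-- Below `α*` the positive zero of the cubic lies below that of the quartic. -/
theorem exists_roots_of_lt_alphaStar {α : ℝ} (h0 : 0 < α) (h : α < alphaStar) :
    ∃ b₁ b₀, 0 < b₁ ∧ b₁ < b₀ ∧ b₀ < 1 - α ∧ cubicDelta α b₁ = 0 ∧ quarticF0 α b₀ = 0 := by
  have h1 : α < 1 := h.trans alphaStar_lt_one
  have hβ : 0 < 1 - α := by linarith
  have hs2 := Real.sq_sqrt (show (0 : ℝ) ≤ 2 by norm_num)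
  have hs1 : 1 < √2 := by rw [Real.lt_sqrt] <;> norm_num
  have hs3 : √2 < 2 := by rw [Real.sqrt_lt'] <;> norm_num
  have hk : 0 < 1 - α * (3 + √2) := by
    rw [← alphaStar_eq]
    nlinarith
  obtain ⟨b₀, hb₀, hb₀1, hq⟩ := exists_quarticF0_root h0.le h1
  have hg0 := div_sqrt_two_pos h1
  have hcg : 0 < cubicDelta α ((1 - α) / √2) := by
    rw [cubicDelta_div_sqrt_two]
    have : 0 < 2 - √2 := by linarith
    positivity
  have hqg : quarticF0 α ((1 - α) / √2) < 0 := by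
    rw [quarticF0_div_sqrt_two, neg_mul, neg_lt_zero]
    have : 0 < √2 - 1 := by linarith
    positivity
  have hgb : (1 - α) / √2 < b₀ := by
    by_contra! hle
    rcases hle.eq_or_lt with heq | hlt
    · rw [← heq] at hqg
      linarith
    · linarith [quarticF0_strictMono h0.le h1 hb₀.le hlt]
  have hcc : ContinuousOn (cubicDelta α) (Set.Icc 0 ((1 - α) / √2)) := by
    unfold cubicDelta
    fun_prop
  have hlo : cubicDelta α 0 < 0 := by
    have : 0 < α * (1 - α) ^ 2 := by positivity
    simpa [cubicDelta] using this
  obtain ⟨b₁, hb₁, hc⟩ := intermediate_value_Ioo hg0.le hcc ⟨hlo, hcg⟩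
  exact ⟨b₁, b₀, hb₁.1, hb₁.2.trans hgb, hb₀1, hc, hq⟩

theorem exists_tau_alphaStar :
    ∃ t : ℝ, IsTau0 alphaStar t ∧ {l : ℝ | 2 < l ∧ funF1 alphaStar l = 0} = {t} := by
  have h1 := alphaStar_lt_one
  have hc : cubicDelta alphaStar ((1 - alphaStar) / √2) = 0 := by
    rw [cubicDelta_div_sqrt_two, alphaStar_eq]
    ring
  have hq : quarticF0 alphaStar ((1 - alphaStar) / √2) = 0 := by
    rw [quarticF0_div_sqrt_two, alphaStar_eq]
    ring
  have hb := div_sqrt_two_pos h1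
  have hb1 := div_sqrt_two_lt h1
  refine ⟨_, isTau0_paramOfRoot alphaStar_pos.le hb hb1 hq, ?_⟩
  rw [setOf_funF1_eq_pair alphaStar_pos.le hb hb1 hq hb hb1 hc, Set.pair_eq_singleton]

theorem exists_root_alpha_zero :
    ∃ b, 0 < b ∧ b < 1 - (0 : ℝ) ∧ quarticF0 0 b = 0 ∧ paramOfRoot 0 b = √(2 + √5) := by
  obtain ⟨b, hb, hb1, hq⟩ := exists_quarticF0_root le_rfl (zero_lt_one (α := ℝ))
  refine ⟨b, hb, hb1, hq, ?_⟩
  have hp : paramOfRoot 0 b = b + 1 / b := by simp [paramOfRoot]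
  have hu : b ^ 4 + b ^ 2 = 1 := by
    unfold quarticF0 at hq
    linarith
  -- From b⁴ + b² = 1 one gets (2b² + 1)² = 5 and 1/b² = b² + 1, hence (b + 1/b)² = 2b² + 3 = 2 +
  -- √5.
  have h5 : √5 = 2 * b ^ 2 + 1 := by
    rw [Real.sqrt_eq_iff_mul_self_eq_of_pos (by positivity)]
    linarith
  rw [hp, eq_comm, Real.sqrt_eq_iff_mul_self_eq_of_pos (by positivity), h5]
  field_simp
  linear_combination -hu

theorem cubicDelta_zero_pos {b : ℝ} (hb : 0 < b) : 0 < cubicDelta 0 b := by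
  have : cubicDelta 0 b = b ^ 3 := by simp [cubicDelta]
  rw [this]
  positivity

theorem setOf_funF1_zero {b : ℝ} (hb : 0 < b) (hb1 : b < 1 - (0 : ℝ))
    (hq : quarticF0 0 b = 0) : {l | 2 < l ∧ funF1 0 l = 0} = {paramOfRoot 0 b} := by
  rw [setOf_eq_image_paramOfRoot zero_lt_one, ← Set.image_singleton]
  congr 1
  ext b'
  constructor
  · rintro ⟨⟨hb', hb1'⟩, h'⟩
    rcases (funF1_eq_zero_iff le_rfl hb' hb1').1 h' with h' | h'
    · exact absurd h' (cubicDelta_zero_pos hb').ne'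
    · exact (quarticF0_eq_zero_iff le_rfl zero_lt_one hb hq hb').1 h'
  · rintro rfl
    exact ⟨⟨hb, hb1⟩, (funF1_eq_zero_iff le_rfl hb hb1).2 (Or.inr hq)⟩

/-! ### Greedy pivot sequences -/

/-- A sequence of pivots `c` kept in `[b, b + δ)` by subtracting as many multiples `r n * δ`
as possible. -/
theorem exists_greedy_pivots {β b δ κ : ℝ} (hb : 0 < b) (hδ : 0 < δ) (hκ : b ≤ κ) :
    ∃ (c : ℕ → ℝ) (r : ℕ → ℕ), (∀ n, b ≤ c n ∧ c n < b + δ) ∧ c 0 = κ - r 0 * δ ∧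
      ∀ n, c (n + 1) = b + β ^ 2 / b - r (n + 1) * δ - β ^ 2 / c n := by
  let q : ℝ → ℕ := fun y => ⌊(y - b) / δ⌋₊
  have hq : ∀ y, b ≤ y → b ≤ y - q y * δ ∧ y - q y * δ < b + δ := by
    intro y hy
    have h1 : (q y : ℝ) ≤ (y - b) / δ := Nat.floor_le (div_nonneg (by linarith) hδ.le)
    have h2 : (y - b) / δ < q y + 1 := Nat.lt_floor_add_one _
    rw [le_div_iff₀ hδ] at h1
    rw [div_lt_iff₀ hδ] at h2
    constructor <;> linarith
  let raw : ℝ → ℝ := fun y => b + β ^ 2 / b - β ^ 2 / y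
  -- `raw` is increasing and fixes b, so the value before any subtraction is still at least b.
  have hraw : ∀ y, b ≤ y → b ≤ raw y := by
    intro y hy
    have : β ^ 2 / y ≤ β ^ 2 / b := div_le_div_of_nonneg_left (sq_nonneg β) hb hy
    simp only [raw]
    linarith
  let c : ℕ → ℝ := fun n =>
    Nat.rec (κ - q κ * δ) (fun _ y => raw y - q (raw y) * δ) n
  have hc : ∀ n, b ≤ c n ∧ c n < b + δ := by
    intro n
    induction n with
    | zero => exact hq κ hκ
    | succ n ih => exact hq _ (hraw _ ih.1)
  let r : ℕ → ℕ := fun n => Nat.casesOn n (q κ) (fun k => q (raw (c k)))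
  refine ⟨c, r, hc, rfl, fun n => ?_⟩
  change raw (c n) - q (raw (c n)) * δ
    = b + β ^ 2 / b - q (raw (c n)) * δ - β ^ 2 / c n
  simp only [raw]
  ring

section Pivots

variable {β b δ : ℝ} {c : ℕ → ℝ} {r : ℕ → ℕ} {x : ℕ → ℝ}

/-- Across a step with `r (m + 1) ≠ 0` the sequence `x` is dominated by its mirror image, as far
back as `r` vanishes. -/
theorem pivots_reflection (hβ : 0 < β) (hb : 0 < b) (hδ : 0 < δ)
    (hc : ∀ n, b ≤ c n ∧ c n < b + δ)
    (hrec : ∀ n, c (n + 1) = b + β ^ 2 / b - r (n + 1) * δ - β ^ 2 / c n)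
    (hx : ∀ n, 0 < x n) (hxc : ∀ n, β * x (n + 1) = c n * x n)
    (hF1 : (b + β ^ 2 / b - δ) * (b + δ) ≤ 2 * β ^ 2)
    {n m : ℕ} (hr0 : ∀ i, n < i → i ≤ m → r i = 0) (hr : r (m + 1) ≠ 0) (j : ℕ) :
    ∀ i, i + j = m → n ≤ i → c (m + 1 + j) * c i ≤ β ^ 2 ∧ x (m + 2 + j) ≤ x i := by
  have hcp : ∀ n, 0 < c n := fun n => hb.trans_le (hc n).1
  induction j with
  | zero =>
    rintro i rfl hi
    -- The product is (l - 2α - rδ)cᵢ - β² with r ≥ 1 and cᵢ < b + δ, so F₁ ≤ 0 bounds it by β².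
    have h1 : c (i + 1) * c i ≤ β ^ 2 := by
      have hr1 : (1 : ℝ) ≤ r (i + 1) := by exact_mod_cast Nat.one_le_iff_ne_zero.2 hr
      have e : c (i + 1) * c i = (b + β ^ 2 / b - r (i + 1) * δ) * c i - β ^ 2 := by
        have := (hcp i).ne'
        rw [hrec i]
        field_simp
      have hpos : 0 < b + β ^ 2 / b - r (i + 1) * δ := by
        have := hrec i
        have := hcp (i + 1)
        have : 0 < β ^ 2 / c i := div_pos (by positivity) (hcp i)
        linarith
      have h2 : (b + β ^ 2 / b - r (i + 1) * δ) * c i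
          ≤ (b + β ^ 2 / b - r (i + 1) * δ) * (b + δ) :=
        mul_le_mul_of_nonneg_left (hc i).2.le hpos.le
      have h3 : (b + β ^ 2 / b - r (i + 1) * δ) * (b + δ)
          ≤ (b + β ^ 2 / b - δ) * (b + δ) := by
        apply mul_le_mul_of_nonneg_right _ (by positivity)
        nlinarith
      linarith
    refine ⟨h1, ?_⟩
    have e : β ^ 2 * x (i + 2) = c (i + 1) * c i * x i := by
      linear_combination β * hxc (i + 1) + c (i + 1) * hxc i
    have : β ^ 2 * x (i + 2) ≤ β ^ 2 * x i := by
      rw [e]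
      exact mul_le_mul_of_nonneg_right h1 (hx i).le
    exact le_of_mul_le_mul_left this (by positivity)
  | succ j ih =>
    intro i hi hni
    obtain ⟨h1, -⟩ := ih (i + 1) (by omega) (by omega)
    obtain ⟨-, h2⟩ := ih (i + 1) (by omega) (by omega)
    have hz : r (i + 1) = 0 := hr0 _ (by omega) (by omega)
    have e1 := hrec i
    rw [hz] at e1
    have e2 := hrec (m + 1 + j)
    -- No leaf is attached at i + 1, so cᵢ₊₁ + β²/cᵢ = b + β²/b. On the other side of the mirror the
    -- next pivot is at most b + β²/b - β²/c(m+1+j), hence at most b + β²/b - cᵢ₊₁ = β²/cᵢ.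
    have h3 : c (i + 1) ≤ β ^ 2 / c (m + 1 + j) := by
      rw [le_div_iff₀ (hcp _)]
      linarith
    have h4 : c (m + 1 + j + 1) ≤ β ^ 2 / c i := by
      have : 0 ≤ (r (m + 1 + j + 1) : ℝ) * δ := by positivity
      push_cast at e1
      linarith
    have h5 : c (m + 1 + (j + 1)) * c i ≤ β ^ 2 := by
      rwa [le_div_iff₀ (hcp _)] at h4
    refine ⟨h5, ?_⟩
    have e3 := hxc (m + 2 + j)
    have e4 : m + 2 + j = m + 1 + (j + 1) := by omega
    have h6 : β * x (m + 2 + j + 1) ≤ c (m + 1 + (j + 1)) * x (i + 1) := by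
      rw [e3, ← e4]
      exact mul_le_mul_of_nonneg_left h2 (hcp _).le
    have h7 : β ^ 2 * x (m + 2 + j + 1) ≤ β ^ 2 * x i :=
      calc β ^ 2 * x (m + 2 + j + 1) = β * (β * x (m + 2 + j + 1)) := by ring
        _ ≤ β * (c (m + 1 + (j + 1)) * x (i + 1)) := mul_le_mul_of_nonneg_left h6 hβ.le
        _ = c (m + 1 + (j + 1)) * c i * x i := by
          linear_combination c (m + 1 + (j + 1)) * hxc i
        _ ≤ β ^ 2 * x i := mul_le_mul_of_nonneg_right h5 (hx i).le
    exact le_of_mul_le_mul_left h7 (by positivity)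

/-- While r vanishes, c iterates y ↦ b + β²/b - β²/y, whose fixed points are b and β²/b. Between
them the iteration increases. Since b + δ < β²/b, a pivot starting above β would grow by at least a
fixed η at every step and leave [b, b + δ). -/
theorem exists_ne_zero_after (hβ : 0 < β) (hb : 0 < b) (hbβ : b < β)
    (hc : ∀ n, b ≤ c n ∧ c n < b + δ)
    (hrec : ∀ n, c (n + 1) = b + β ^ 2 / b - r (n + 1) * δ - β ^ 2 / c n)
    (hF0 : b + δ < β ^ 2 / b) {n : ℕ} (hn : β < c n) : ∃ k, r (n + k + 1) ≠ 0 := by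
  by_contra! hz
  have hβδ : β < b + δ := hn.trans (hc n).2
  set η := (β - b) * (β ^ 2 / b - (b + δ)) / (b + δ) with hη
  have hbδ : 0 < b + δ := by linarith
  have hη0 : 0 < η := div_pos (mul_pos (by linarith) (by linarith)) hbδ
  have hgrow : ∀ k : ℕ, β + k * η ≤ c (n + k) := by
    intro k
    induction k with
    | zero => simpa using hn.le
    | succ k ih =>
      have hk : β ≤ c (n + k) := by
        have : 0 ≤ (k : ℝ) * η := by positivity
        linarith
      have hck := (hc (n + k)).2
      have hcp : 0 < c (n + k) := hβ.trans_le hk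
      have e : c (n + k + 1) - c (n + k)
          = (c (n + k) - b) * (β ^ 2 / b - c (n + k)) / c (n + k) := by
        rw [hrec, hz]
        field_simp
        push_cast
        ring
      have : η ≤ c (n + k + 1) - c (n + k) := by
        rw [e, hη]
        apply div_le_div₀ _ _ hcp hck.le
        · exact mul_nonneg (by linarith) (by linarith)
        · exact mul_le_mul (by linarith) (by linarith) (by linarith) (by linarith)
      push_cast
      rw [← add_assoc]
      linarith
  obtain ⟨k, hk⟩ := exists_nat_gt ((b + δ) / η)
  rw [div_lt_iff₀ hη0] at hk
  linarith [hgrow k, (hc (n + k)).2]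

/-- If cₙ ≤ β, the next value of x is already no larger. Otherwise the first later vertex with
leaves serves as a mirror. -/
theorem exists_later_le (hβ : 0 < β) (hb : 0 < b) (hbβ : b < β) (hδ : 0 < δ)
    (hc : ∀ n, b ≤ c n ∧ c n < b + δ)
    (hrec : ∀ n, c (n + 1) = b + β ^ 2 / b - r (n + 1) * δ - β ^ 2 / c n)
    (hx : ∀ n, 0 < x n) (hxc : ∀ n, β * x (n + 1) = c n * x n)
    (hF0 : b + δ < β ^ 2 / b) (hF1 : (b + β ^ 2 / b - δ) * (b + δ) ≤ 2 * β ^ 2) (n : ℕ) :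
    ∃ m, n < m ∧ x m ≤ x n := by
  classical
  rcases le_or_gt (c n) β with hn | hn
  · refine ⟨n + 1, n.lt_succ_self, ?_⟩
    have : β * x (n + 1) ≤ β * x n := by
      rw [hxc]
      exact mul_le_mul_of_nonneg_right hn (hx n).le
    exact le_of_mul_le_mul_left this hβ
  · have hex := exists_ne_zero_after hβ hb hbβ hc hrec hF0 hn
    have hmin : ∀ i, n < i → i ≤ n + Nat.find hex → r i = 0 := by
      intro i hi hi'
      have := Nat.find_min hex (m := i - n - 1) (by omega)
      rwa [not_not, show n + (i - n - 1) + 1 = i by omega] at this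
    -- With m = n + k and m + 1 the first vertex with leaves after n, this is the mirror image m + 2
    -- + k of n = m - k.
    refine ⟨n + Nat.find hex + 2 + Nat.find hex, by omega, ?_⟩
    exact (pivots_reflection hβ hb hδ hc hrec hx hxc hF1 hmin (Nat.find_spec hex)
      (Nat.find hex) n rfl le_rfl).2

end Pivots

/-- A sequence that always returns to its earlier values has arbitrarily late record minima. -/
theorem exists_record_min {x : ℕ → ℝ} (h : ∀ n, ∃ m, n < m ∧ x m ≤ x n) (N : ℕ) :
    ∃ n, N ≤ n ∧ ∀ i ≤ n, x n ≤ x i := by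
  induction N with
  | zero => exact ⟨0, le_rfl, fun i hi => by rw [Nat.le_zero.1 hi]⟩
  | succ N ih =>
    obtain ⟨n, hn, hmin⟩ := ih
    obtain ⟨m, hm, hmn⟩ := h n
    -- The minimum over (n, m] is at most x m ≤ x n, so it is also at most everything up to n.
    obtain ⟨k, hk, hkmin⟩ := (Finset.Ioc n m).exists_min_image x ⟨m, by simp [hm]⟩
    rw [Finset.mem_Ioc] at hk
    refine ⟨k, by omega, fun i hi => ?_⟩
    rcases le_or_gt i n with hin | hin
    · exact ((hkmin m (by simp [hm])).trans hmn).trans (hmin i hin)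
    · exact hkmin i (Finset.mem_Ioc.2 ⟨hin, hi.trans hk.2⟩)

/-! ### Bounds for the largest eigenvalue -/

section Radius

variable {V : Type*} [Fintype V]

open Classical in
theorem alphaMatrix_apply (α : ℝ) (G : SimpleGraph V) (u v : V) :
    alphaMatrix α G u v
      = (if u = v then α * G.degree u else 0) + if G.Adj u v then 1 - α else 0 := by
  simp only [alphaMatrix, SimpleGraph.degMatrix, Matrix.add_apply, Matrix.smul_apply,
    Matrix.sub_apply, SimpleGraph.adjMatrix_apply, Matrix.diagonal_apply, smul_eq_mul]
  split_ifs <;> ring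

open Classical in
theorem alphaMatrix_mulVec (α : ℝ) (G : SimpleGraph V) (x : V → ℝ) (u : V) :
    Matrix.mulVec (alphaMatrix α G) x u
      = ∑ v, if G.Adj u v then α * x u + (1 - α) * x v else 0 := by
  have hd : (G.degree u : ℝ) = ∑ v, if G.Adj u v then 1 else 0 := by
    rw [← SimpleGraph.card_neighborFinset_eq_degree, Finset.sum_boole]
    congr 2
    ext v
    simp
  simp only [Matrix.mulVec, dotProduct, alphaMatrix_apply, add_mul, ite_mul, zero_mul,
    Finset.sum_add_distrib, Finset.sum_ite_eq, Finset.mem_univ, if_true, hd, Finset.mul_sum,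
    Finset.sum_mul]
  rw [← Finset.sum_add_distrib]
  refine Finset.sum_congr rfl fun v _ => ?_
  split_ifs <;> ring

open Classical in
theorem alphaMatrix_isHermitian (α : ℝ) (G : SimpleGraph V) : (alphaMatrix α G).IsHermitian := by
  ext u v
  rw [Matrix.conjTranspose_apply, star_trivial, alphaMatrix_apply, alphaMatrix_apply]
  simp only [G.adj_comm u v, eq_comm (a := u)]
  congr 1
  split_ifs with h
  · rw [h]
  · rfl

theorem alphaMatrix_nonneg {α : ℝ} (h0 : 0 ≤ α) (h1 : α < 1) (G : SimpleGraph V) (u v : V) :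
    0 ≤ alphaMatrix α G u v := by
  classical
  rw [alphaMatrix_apply]
  have : 0 < 1 - α := by linarith
  positivity

theorem alphaMatrix_pos {α : ℝ} (h1 : α < 1) {G : SimpleGraph V} {u v : V} (h : G.Adj u v) :
    0 < alphaMatrix α G u v := by
  classical
  rw [alphaMatrix_apply, if_neg h.ne, if_pos h]
  linarith

open Classical in
theorem finite_spectrum_alphaMatrix (α : ℝ) (G : SimpleGraph V) :
    (spectrum ℝ (alphaMatrix α G)).Finite := by
  rw [(alphaMatrix_isHermitian α G).spectrum_real_eq_range_eigenvalues]
  exact Set.finite_range _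

open Classical in
theorem alphaRadius_mem_spectrum [Nonempty V] (α : ℝ) (G : SimpleGraph V) :
    alphaRadius α G ∈ spectrum ℝ (alphaMatrix α G) := by
  refine Set.Nonempty.csSup_mem ?_ (finite_spectrum_alphaMatrix α G)
  rw [(alphaMatrix_isHermitian α G).spectrum_real_eq_range_eigenvalues]
  exact Set.range_nonempty _

theorem exists_eigenvector_alphaRadius [Nonempty V] (α : ℝ) (G : SimpleGraph V) :
    ∃ y : V → ℝ, y ≠ 0 ∧ Matrix.mulVec (alphaMatrix α G) y = alphaRadius α G • y := by
  classical
  have h := alphaRadius_mem_spectrum α G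
  rw [← Matrix.spectrum_toLin', ← Module.End.hasEigenvalue_iff_mem_spectrum] at h
  obtain ⟨y, hy⟩ := h.exists_hasEigenvector
  exact ⟨y, hy.2, by simpa using hy.apply_eq_smul⟩

/-- The matrix ρI - A_α is Hermitian and its spectrum consists of the numbers ρ - μ ≥ 0, so it is
positive semidefinite. -/
theorem rayleigh_le_alphaRadius (α : ℝ) (G : SimpleGraph V) (x : V → ℝ) :
    x ⬝ᵥ Matrix.mulVec (alphaMatrix α G) x ≤ alphaRadius α G * (x ⬝ᵥ x) := by
  classical
  have hps : (algebraMap ℝ (Matrix V V ℝ) (alphaRadius α G) - alphaMatrix α G).PosSemidef := by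
    rw [Matrix.posSemidef_iff_isHermitian_and_spectrum_nonneg]
    refine ⟨?_, ?_⟩
    · refine Matrix.IsHermitian.sub ?_ (alphaMatrix_isHermitian α G)
      rw [Matrix.algebraMap_eq_diagonal]
      exact Matrix.isHermitian_diagonal _
    · rw [← spectrum.singleton_sub_eq]
      rintro _ ⟨_, rfl, μ, hμ, rfl⟩
      exact sub_nonneg.2 (le_csSup (finite_spectrum_alphaMatrix α G).bddAbove hμ)
  have h := hps.dotProduct_mulVec_nonneg x
  rw [Matrix.sub_mulVec, dotProduct_sub, Algebra.algebraMap_eq_smul_one, Matrix.smul_mulVec,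
    Matrix.one_mulVec, dotProduct_smul, star_trivial, smul_eq_mul] at h
  linarith

/-- A positive supersolution that is strict somewhere bounds the largest eigenvalue of a connected
graph strictly. -/
theorem alphaRadius_lt_of_supersolution {α l : ℝ} (h0 : 0 ≤ α) (h1 : α < 1) (hl : 0 < l)
    {G : SimpleGraph V} (hG : G.Connected) {x : V → ℝ} (hx : ∀ v, 0 < x v)
    (hsup : ∀ v, Matrix.mulVec (alphaMatrix α G) x v ≤ l * x v)
    {w : V} (hw : Matrix.mulVec (alphaMatrix α G) x w < l * x w) : alphaRadius α G < l := by
  by_contra! hle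
  have := hG.nonempty
  obtain ⟨y, hy0, hy⟩ := exists_eigenvector_alphaRadius α G
  obtain ⟨u, -, hu⟩ :=
    Finset.univ.exists_max_image (fun v => |y v| / x v) Finset.univ_nonempty
  set M := |y u| / x u
  have hM : ∀ v, |y v| ≤ M * x v := fun v => by
    rw [← div_le_iff₀ (hx v)]
    exact hu v (Finset.mem_univ v)
  have hMpos : 0 < M := by
    obtain ⟨v, hv⟩ := Function.ne_iff.1 hy0
    have : 0 < |y v| := abs_pos.2 hv
    exact pos_of_mul_pos_left (this.trans_le (hM v)) (hx v).le
  -- Maximum principle: if ρ ≥ l, then at a vertex where |y|/x attains its maximum M the chain l·M·x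
  -- ≤ A_α|y| ≤ M·A_α x ≤ l·M·x collapses to equalities. So x is not strict there, and every
  -- neighbour attains M as well.
  have key : ∀ v, |y v| = M * x v →
      Matrix.mulVec (alphaMatrix α G) x v = l * x v ∧ ∀ z, G.Adj v z → |y z| = M * x z := by
    intro v hv
    have e : alphaRadius α G * y v = ∑ z, alphaMatrix α G v z * y z := by
      rw [← smul_eq_mul, ← Pi.smul_apply, ← hy]
      rfl
    have i1 : l * |y v| ≤ ∑ z, alphaMatrix α G v z * |y z| :=
      calc l * |y v| ≤ alphaRadius α G * |y v| :=
            mul_le_mul_of_nonneg_right hle (abs_nonneg _)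
        _ = |∑ z, alphaMatrix α G v z * y z| := by
          rw [← e, abs_mul, abs_of_pos (hl.trans_le hle)]
        _ ≤ ∑ z, |alphaMatrix α G v z * y z| := Finset.abs_sum_le_sum_abs _ _
        _ = ∑ z, alphaMatrix α G v z * |y z| := by
          refine Finset.sum_congr rfl fun z _ => ?_
          rw [abs_mul, abs_of_nonneg (alphaMatrix_nonneg h0 h1 G v z)]
    have hterm : ∀ z ∈ Finset.univ, 0 ≤ alphaMatrix α G v z * (M * x z - |y z|) := fun z _ =>
      mul_nonneg (alphaMatrix_nonneg h0 h1 G v z) (sub_nonneg.2 (hM z))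
    have i2 : ∑ z, alphaMatrix α G v z * (M * x z - |y z|)
        = M * Matrix.mulVec (alphaMatrix α G) x v - ∑ z, alphaMatrix α G v z * |y z| := by
      simp only [Matrix.mulVec, dotProduct, Finset.mul_sum, ← Finset.sum_sub_distrib]
      exact Finset.sum_congr rfl fun z _ => by ring
    have i3 := Finset.sum_nonneg hterm
    have i4 := mul_le_mul_of_nonneg_left (hsup v) hMpos.le
    have i5 : l * |y v| = M * (l * x v) := by
      rw [hv]
      ring
    refine ⟨mul_left_cancel₀ hMpos.ne' (le_antisymm i4 (by linarith)), fun z hz => ?_⟩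
    have hsum : ∑ z, alphaMatrix α G v z * (M * x z - |y z|) = 0 := by linarith
    have := (Finset.sum_eq_zero_iff_of_nonneg hterm).1 hsum z (Finset.mem_univ z)
    rcases mul_eq_zero.1 this with h | h
    · exact absurd h (alphaMatrix_pos h1 hz).ne'
    · linarith
  have hall : |y w| = M * x w := by
    obtain ⟨p⟩ := hG.preconnected u w
    have hstart : |y u| = M * x u := (div_mul_cancel₀ _ (hx u).ne').symm
    -- The induction along the walk varies its start u, on which the value of M depends.
    clear_value M
    clear hw hu
    induction p with
    | nil => exact hstart
    | cons h _ ih => exact ih ((key _ hstart).2 _ h)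
  exact hw.ne (key w hall).1

theorem alphaRadius_iso {W : Type*} [Fintype W] (α : ℝ) {G : SimpleGraph V} {H : SimpleGraph W}
    (e : G ≃g H) : alphaRadius α H = alphaRadius α G := by
  classical
  have h : alphaMatrix α H = Matrix.reindexAlgEquiv ℝ ℝ e.toEquiv (alphaMatrix α G) := by
    ext u v
    obtain ⟨u, rfl⟩ := e.surjective u
    obtain ⟨v, rfl⟩ := e.surjective v
    have hs : ∀ z, e.toEquiv.symm (e z) = z := e.symm_apply_apply
    rw [Matrix.coe_reindexAlgEquiv, Matrix.reindex_apply, Matrix.submatrix_apply, hs, hs,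
      alphaMatrix_apply, alphaMatrix_apply, e.degree_eq]
    simp only [e.map_adj_iff, e.injective.eq_iff]
  unfold alphaRadius
  rw [h]
  congr 1
  convert AlgEquiv.spectrum_eq (Matrix.reindexAlgEquiv ℝ ℝ e.toEquiv) (alphaMatrix α G)

theorem exists_fin_graph_alphaRadius_eq [Nonempty V] (α : ℝ) (G : SimpleGraph V) :
    ∃ (n : ℕ) (H : SimpleGraph (Fin (n + 1))), alphaRadius α H = alphaRadius α G := by
  obtain ⟨n, hn⟩ := Nat.exists_eq_succ_of_ne_zero (Fintype.card_ne_zero (α := V))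
  let e : V ≃ Fin (n + 1) := Fintype.equivFinOfCardEq hn
  exact ⟨n, G.map e.toEmbedding, alphaRadius_iso α (SimpleGraph.Iso.map e G)⟩

end Radius

/-! ### Caterpillars -/

/-- The caterpillar with spine `0, …, n` and `r i` leaves attached to the `i`-th spine vertex. -/
def caterpillar (n : ℕ) (r : ℕ → ℕ) :
    SimpleGraph (Fin (n + 1) ⊕ (Σ i : Fin (n + 1), Fin (r i))) where
  Adj
    | .inl i, .inl j => (i : ℕ) + 1 = j ∨ (j : ℕ) + 1 = i
    | .inl i, .inr p => p.1 = i
    | .inr p, .inl i => p.1 = i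
    | .inr _, .inr _ => False
  symm := ⟨by
    rintro (i | p) (j | q) h
    · exact h.symm
    · exact h
    · exact h
    · exact h⟩
  loopless := ⟨by
    rintro (i | p) h
    · rcases h with h | h <;> omega
    · exact h⟩

theorem caterpillar_connected (n : ℕ) (r : ℕ → ℕ) : (caterpillar n r).Connected := by
  have hs : ∀ (k : ℕ) (hk : k < n + 1),
      (caterpillar n r).Reachable (.inl 0) (.inl ⟨k, hk⟩) := by
    intro k
    induction k with
    | zero => exact fun _ => SimpleGraph.Reachable.refl _
    | succ k ih =>
      intro hk
      refine (ih (by omega)).trans (SimpleGraph.Adj.reachable ?_)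
      exact Or.inl rfl
  have h : ∀ v, (caterpillar n r).Reachable (.inl 0) v := by
    rintro (i | p)
    · exact hs i i.2
    · refine (hs p.1 p.1.2).trans (SimpleGraph.Adj.reachable ?_)
      exact rfl
  exact SimpleGraph.connected_iff_exists_forall_reachable _ |>.2 ⟨_, h⟩

/-- The vector with entries `x i` on the spine and `β x i / (l - α)` on the leaves. -/
noncomputable def caterpillarVec (α l : ℝ) (n : ℕ) (r : ℕ → ℕ) (x : ℕ → ℝ) :
    (Fin (n + 1) ⊕ (Σ i : Fin (n + 1), Fin (r i))) → ℝ
  | .inl i => x i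
  | .inr p => (1 - α) * x p.1 / (l - α)

theorem sum_fin_path (n : ℕ) (i : Fin (n + 1)) (g : ℕ → ℝ) :
    (∑ j : Fin (n + 1), if (i : ℕ) + 1 = j ∨ (j : ℕ) + 1 = i then g j else 0)
      = (if (i : ℕ) < n then g (i + 1) else 0) + if 0 < (i : ℕ) then g (i - 1) else 0 := by
  rw [Fin.sum_univ_eq_sum_range
    (fun j => if (i : ℕ) + 1 = j ∨ j + 1 = (i : ℕ) then g j else 0) (n + 1)]
  -- The guard 0 < i excludes the truncated value 0 - 1 = 0.
  have hsplit : ∀ j, (if (i : ℕ) + 1 = j ∨ j + 1 = (i : ℕ) then g j else 0)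
      = (if (i : ℕ) + 1 = j then g j else 0)
        + if 0 < (i : ℕ) then (if (i : ℕ) - 1 = j then g j else 0) else 0 := by
    intro j
    split_ifs <;> first | omega | simp
  simp only [hsplit, Finset.sum_add_distrib, Finset.sum_ite_eq, Finset.mem_range]
  congr 1
  · simp
  · split_ifs with h
    · rw [Finset.sum_ite_eq, if_pos]
      simp only [Finset.mem_range]
      omega
    · simp

theorem caterpillar_mulVec_leaf {α l : ℝ} (hl : α < l) (n : ℕ) (r : ℕ → ℕ) (x : ℕ → ℝ)
    (p : Σ i : Fin (n + 1), Fin (r i)) :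
    Matrix.mulVec (alphaMatrix α (caterpillar n r)) (caterpillarVec α l n r x) (.inr p)
      = l * caterpillarVec α l n r x (.inr p) := by
  classical
  have h : l - α ≠ 0 := by linarith
  have h1 : ∀ j : Fin (n + 1), (caterpillar n r).Adj (.inr p) (.inl j) ↔ p.1 = j :=
    fun j => Iff.rfl
  have h2 : ∀ q, ¬ (caterpillar n r).Adj (.inr p) (.inr q) := fun q => id
  rw [alphaMatrix_mulVec, Fintype.sum_sum_type,
    Finset.sum_congr rfl fun j _ => if_congr (h1 j) rfl rfl,
    Finset.sum_congr rfl fun q _ => if_neg (h2 q)]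
  simp only [caterpillarVec, Finset.sum_const_zero, add_zero,
    Finset.sum_ite_eq, Finset.mem_univ, if_true]
  field_simp
  ring

/-- The leaf entry βxᵢ/(l - α) solves the eigenvalue equation at the leaf, so each leaf contributes
(α + β²/(l - α))xᵢ = δxᵢ to its spine vertex. -/
theorem caterpillar_mulVec_spine {α l : ℝ} (hl : α < l) (n : ℕ) (r : ℕ → ℕ) (x : ℕ → ℝ)
    (i : Fin (n + 1)) :
    Matrix.mulVec (alphaMatrix α (caterpillar n r)) (caterpillarVec α l n r x) (.inl i)
      = (if (i : ℕ) < n then α * x i + (1 - α) * x (i + 1) else 0)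
        + (if 0 < (i : ℕ) then α * x i + (1 - α) * x (i - 1) else 0)
        + r i * deltaAlpha α l * x i := by
  classical
  have h : l - α ≠ 0 := by linarith
  have h1 : ∀ j : Fin (n + 1), (caterpillar n r).Adj (.inl i) (.inl j) ↔
      (i : ℕ) + 1 = j ∨ (j : ℕ) + 1 = i := fun j => Iff.rfl
  have h2 : ∀ q : Σ i : Fin (n + 1), Fin (r i),
      (caterpillar n r).Adj (.inl i) (.inr q) ↔ q.1 = i := fun q => Iff.rfl
  rw [alphaMatrix_mulVec, Fintype.sum_sum_type,
    Finset.sum_congr rfl fun j _ => if_congr (h1 j) rfl rfl,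
    Finset.sum_congr rfl fun q _ => if_congr (h2 q) rfl rfl, Fintype.sum_sigma]
  simp only [caterpillarVec]
  congr 1
  · exact sum_fin_path n i (fun j => α * x i + (1 - α) * x j)
  · rw [Finset.sum_eq_single i
      (fun j _ hj => Finset.sum_eq_zero fun _ _ => if_neg hj) (by simp),
      Finset.sum_congr rfl fun _ _ => if_pos rfl, Finset.sum_const, Finset.card_univ,
      Fintype.card_fin, nsmul_eq_mul]
    unfold deltaAlpha
    field_simp

/-- In a caterpillar built from a pivot sequence `c`, the vector belonging to `c` is an
eigenvector up to a defect at the last spine vertex. -/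
theorem caterpillar_mulVec_pivots {α l : ℝ} (h1 : α < 1) (hl : 2 < l)
    {c x : ℕ → ℝ} {r : ℕ → ℕ} (hc : ∀ n, 0 < c n)
    (hc0 : c 0 = l - α - r 0 * deltaAlpha α l)
    (hrec : ∀ n, c (n + 1) = l - 2 * α - r (n + 1) * deltaAlpha α l - (1 - α) ^ 2 / c n)
    (hxc : ∀ n, (1 - α) * x (n + 1) = c n * x n) (n : ℕ)
    (v : Fin (n + 1) ⊕ (Σ i : Fin (n + 1), Fin (r i))) :
    Matrix.mulVec (alphaMatrix α (caterpillar n r)) (caterpillarVec α l n r x) v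
      = l * caterpillarVec α l n r x v
        - if v = .inl (Fin.last n) then (c n + α) * x n else 0 := by
  have hlα : α < l := by linarith
  rcases v with i | p
  · rw [caterpillar_mulVec_spine hlα]
    have hlast : (Sum.inl i : Fin (n + 1) ⊕ (Σ i : Fin (n + 1), Fin (r i)))
        = .inl (Fin.last n) ↔ ¬ (i : ℕ) < n := by
      rw [Sum.inl.injEq, Fin.ext_iff, Fin.val_last]
      omega
    -- Everything except the right spine neighbour sums to l·xᵢ - (cᵢ + α)xᵢ. A right neighbour
    -- would restore αxᵢ + βxᵢ₊₁ = (α + cᵢ)xᵢ, and only the last vertex lacks one. The initial pivot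
    -- carries l - α instead of l - 2α because vertex 0 has no left neighbour.
    have hbulk : ((if 0 < (i : ℕ) then α * x i + (1 - α) * x (i - 1) else 0)
        + r i * deltaAlpha α l * x i) = l * x i - (c i + α) * x i := by
      rcases Nat.eq_zero_or_pos (i : ℕ) with h | h
      · rw [h, if_neg (lt_irrefl 0), hc0]
        ring
      · obtain ⟨k, hk⟩ := Nat.exists_eq_succ_of_ne_zero h.ne'
        rw [hk, if_pos k.succ_pos, Nat.succ_eq_add_one, Nat.add_sub_cancel, hrec]
        have hx : (1 - α) ^ 2 / c k * x (k + 1) = (1 - α) * x k := by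
          rw [div_mul_eq_mul_div, div_eq_iff (hc k).ne']
          linear_combination (1 - α) * hxc k
        linear_combination -hx
    rw [add_assoc, hbulk]
    simp only [hlast, caterpillarVec]
    by_cases hi : (i : ℕ) < n
    · rw [if_pos hi, if_neg (not_not.2 hi)]
      linear_combination hxc i
    · have : (i : ℕ) = n := by omega
      rw [if_neg hi, if_pos hi, this]
      ring
  · rw [caterpillar_mulVec_leaf hlα, if_neg (by simp), sub_zero]

/-- If `F₀ < 0` and `F₁ ≤ 0` at `l`, then `l` is a limit from below of largest eigenvalues of
caterpillars. -/
theorem exists_graph_alphaRadius_near {α l ε : ℝ} (h0 : 0 ≤ α) (h1 : α < 1) (hl : 2 < l)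
    (hF0 : funF0 α l < 0) (hF1 : funF1 α l ≤ 0) (hε : 0 < ε) :
    ∃ (n : ℕ) (G : SimpleGraph (Fin (n + 1))), l - ε < alphaRadius α G ∧ alphaRadius α G < l := by
  obtain ⟨hb, hb1, -⟩ := negTheta_spec h1 hl
  have hparam := paramOfRoot_negTheta h1 hl
  have hδ := deltaAlpha_pos h0 h1 hl
  rw [funF0_eq h1 hl] at hF0
  have hF1' : funF1 α l = (l - 2 * α - deltaAlpha α l) * (-thetaAlpha' α l + deltaAlpha α l)
      - 2 * (1 - α) ^ 2 := by
    unfold funF1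
    ring
  rw [hF1'] at hF1
  set b := -thetaAlpha' α l
  set δ := deltaAlpha α l with hδdef
  have hβ : 0 < 1 - α := by linarith
  have hκ : b + (1 - α) ^ 2 / b = l - 2 * α := by
    unfold paramOfRoot at hparam
    linarith
  obtain ⟨c, r, hc, hc0, hrec⟩ := exists_greedy_pivots (β := 1 - α) (κ := l - α) hb hδ
    (by linarith)
  have hcp : ∀ n, 0 < c n := fun n => hb.trans_le (hc n).1
  let x : ℕ → ℝ := fun n => ∏ i ∈ Finset.range n, (c i / (1 - α))
  have hx : ∀ n, 0 < x n := fun n => Finset.prod_pos fun i _ => div_pos (hcp i) hβ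
  have hxc : ∀ n, (1 - α) * x (n + 1) = c n * x n := by
    intro n
    simp only [x, Finset.prod_range_succ]
    field_simp
  have hlater := exists_later_le hβ hb hb1 hδ hc hrec hx hxc (by linarith)
    (by rw [hκ]; linarith)
  -- A record minimum at n ≥ N gives a Rayleigh deficit of at most (cₙ + α)/(n + 1), which is less
  -- than ε since cₙ < b + δ.
  obtain ⟨N, hN⟩ := exists_nat_gt ((b + δ + α) / ε)
  obtain ⟨n, hn, hmin⟩ := exists_record_min hlater N
  have hvec := caterpillar_mulVec_pivots h1 hl hcp hc0
    (fun n => by rw [hrec, hκ]) hxc n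
  set X := caterpillarVec α l n r x with hX
  have hXpos : ∀ v, 0 < X v := by
    rintro (i | p)
    · exact hx i
    · exact div_pos (mul_pos hβ (hx _)) (by linarith)
  have hdef : 0 < (c n + α) * x n := mul_pos (by linarith [hcp n]) (hx n)
  obtain ⟨k, H, hH⟩ := exists_fin_graph_alphaRadius_eq α (caterpillar n r)
  refine ⟨k, H, ?_, ?_⟩ <;> rw [hH]
  · have hray := rayleigh_le_alphaRadius α (caterpillar n r) X
    have hdot : X ⬝ᵥ Matrix.mulVec (alphaMatrix α (caterpillar n r)) X
        = l * (X ⬝ᵥ X) - (c n + α) * x n ^ 2 := by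
      have hlast : X (.inl (Fin.last n)) = x n := rfl
      simp only [dotProduct, hvec, mul_sub, Finset.sum_sub_distrib, mul_ite, mul_zero,
        Finset.sum_ite_eq', Finset.mem_univ, if_true, hlast, Finset.mul_sum]
      congr 1
      · exact Finset.sum_congr rfl fun v _ => by ring
      · ring
    have hnorm : (n + 1) * x n ^ 2 ≤ X ⬝ᵥ X := by
      rw [dotProduct, Fintype.sum_sum_type]
      have hA : ((n : ℝ) + 1) * x n ^ 2 ≤ ∑ i : Fin (n + 1), X (.inl i) * X (.inl i) := by
        have hcard : ((n : ℝ) + 1) * x n ^ 2 = ∑ _i : Fin (n + 1), x n ^ 2 := by simp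
        rw [hcard]
        refine Finset.sum_le_sum fun i _ => ?_
        rw [← sq]
        exact pow_le_pow_left₀ (hx n).le (hmin i (Nat.lt_succ_iff.1 i.2)) 2
      have hB : 0 ≤ ∑ p, X (.inr p) * X (.inr p) :=
        Finset.sum_nonneg fun p _ => mul_self_nonneg _
      linarith
    have hxx : 0 < x n ^ 2 := pow_pos (hx n) 2
    have hXX : 0 < X ⬝ᵥ X := lt_of_lt_of_le (by positivity) hnorm
    have hsmall : (c n + α) * x n ^ 2 < ε * (X ⬝ᵥ X) := by
      rw [div_lt_iff₀ hε] at hN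
      have hnN : (N : ℝ) ≤ n := by exact_mod_cast hn
      have : c n + α < ε * (n + 1) := by nlinarith [(hc n).2]
      calc (c n + α) * x n ^ 2 < ε * (n + 1) * x n ^ 2 := mul_lt_mul_of_pos_right this hxx
        _ = ε * ((n + 1) * x n ^ 2) := by ring
        _ ≤ ε * (X ⬝ᵥ X) := mul_le_mul_of_nonneg_left hnorm hε.le
    rw [hdot] at hray
    refine lt_of_mul_lt_mul_right ?_ hXX.le
    linarith
  · refine alphaRadius_lt_of_supersolution h0 h1 (by linarith) (caterpillar_connected n r) hXpos
      (fun v => ?_) (w := .inl (Fin.last n)) ?_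
    · rw [hvec]
      split_ifs <;> linarith
    · rw [hvec, if_pos rfl]
      linarith

/-! ### Limit points -/

theorem isAlphaLimitPoint_of_forall_exists {α l : ℝ}
    (h : ∀ ε : ℝ, 0 < ε → ∃ (n : ℕ) (G : SimpleGraph (Fin (n + 1))),
      alphaRadius α G ≠ l ∧ |alphaRadius α G - l| < ε) : IsAlphaLimitPoint α l := by
  choose! n G hne hlt using h
  -- Each tolerance is at most the previous distance to l, so the distances decrease strictly and
  -- the radii are distinct. The bound 1/(j + 1) forces convergence.
  let d : ℕ → ℝ := fun k =>
    Nat.rec 1 (fun j y => min |alphaRadius α (G y) - l| (1 / ((j : ℝ) + 1))) k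
  have hd : ∀ k, 0 < d k := by
    intro k
    induction k with
    | zero => exact one_pos
    | succ k ih => exact lt_min (abs_pos.2 (sub_ne_zero.2 (hne _ ih))) (by positivity)
  have hanti : StrictAnti fun k => |alphaRadius α (G (d k)) - l| :=
    strictAnti_nat_of_succ_lt fun k => (hlt _ (hd (k + 1))).trans_le (min_le_left _ _)
  refine ⟨fun k => n (d k), fun k => G (d k), fun i j hij => hanti.injective ?_, ?_⟩
  · exact congrArg (fun y => |y - l|) hij
  · rw [← Filter.tendsto_add_atTop_iff_nat 1, tendsto_iff_dist_tendsto_zero]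
    refine squeeze_zero (fun k => dist_nonneg) (fun k => ?_)
      tendsto_one_div_add_atTop_nhds_zero_nat
    rw [Real.dist_eq]
    exact (hlt _ (hd (k + 1))).le.trans (min_le_right _ _)

/-- If every number slightly above `t` is a limit from below of largest eigenvalues, then `t` and
each of these numbers is a limit point. -/
theorem isAlphaLimitPoint_of_Ioo {α t t' : ℝ}
    (h : ∀ l ∈ Set.Ioo t t', ∀ ε : ℝ, 0 < ε → ∃ (n : ℕ) (G : SimpleGraph (Fin (n + 1))),
      l - ε < alphaRadius α G ∧ alphaRadius α G < l) :
    ∀ l ∈ Set.Ico t t', IsAlphaLimitPoint α l := by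
  rintro l ⟨hl, hl'⟩
  refine isAlphaLimitPoint_of_forall_exists fun ε hε => ?_
  rcases hl.eq_or_lt with rfl | hlt
  -- At the endpoint t the hypothesis is not available. Approximating t + s from below within s
  -- gives a radius strictly between t and t + s.
  · set s := min (ε / 2) ((t' - t) / 2) with hs
    have hs0 : 0 < s := lt_min (by linarith) (by linarith)
    have hs1 : s ≤ ε / 2 := min_le_left _ _
    have hs2 : s ≤ (t' - t) / 2 := min_le_right _ _
    obtain ⟨n, G, hG, hG'⟩ := h (t + s) ⟨by linarith, by linarith⟩ s hs0
    refine ⟨n, G, by linarith, ?_⟩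
    rw [abs_lt]
    constructor <;> linarith
  · obtain ⟨n, G, hG, hG'⟩ := h l ⟨hlt, hl'⟩ ε hε
    refine ⟨n, G, hG'.ne, ?_⟩
    rw [abs_lt]
    constructor <;> linarith

theorem exists_tau1Pair {α : ℝ} (h0 : 0 < α) (h : α < alphaStar) :
    ∃ t t' : ℝ, IsTau1Pair α t t' ∧ (∀ l ∈ Set.Ioo t t', funF1 α l < 0) ∧
      ∀ l ∈ Set.Ico t t', IsAlphaLimitPoint α l := by
  have h1 : α < 1 := h.trans alphaStar_lt_one
  obtain ⟨b₁, b₀, hb₁, hlt, hb₀1, hc, hq⟩ := exists_roots_of_lt_alphaStar h0 h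
  have hb₀ := hb₁.trans hlt
  have hb₁1 := hlt.trans hb₀1
  have hF0 : ∀ l ∈ Set.Ioo (paramOfRoot α b₀) (paramOfRoot α b₁), funF0 α l < 0 :=
    fun l hl => funF0_neg h0.le hb₀ hb₀1 hq hl.1
  have h2 : ∀ l ∈ Set.Ioo (paramOfRoot α b₀) (paramOfRoot α b₁), 2 < l :=
    fun l hl => (paramOfRoot_gt_two hb₀ hb₀1).trans hl.1
  have hF1 : ∀ l ∈ Set.Ioo (paramOfRoot α b₀) (paramOfRoot α b₁), funF1 α l < 0 :=
    fun l hl => funF1_neg h0.le h1 (h2 l hl)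
      (cubicDelta_pos_of_lt h0.le hb₁
        (lt_negTheta_of_lt_paramOfRoot hb₁ hb₁1 (h2 l hl) hl.2) hc) (hF0 l hl)
  refine ⟨_, _, ⟨isTau0_paramOfRoot h0.le hb₀ hb₀1 hq, paramOfRoot_strictAnti hb₁ hlt hb₀1,
    setOf_funF1_eq_pair h0.le hb₀ hb₀1 hq hb₁ hb₁1 hc⟩, hF1, ?_⟩
  exact isAlphaLimitPoint_of_Ioo fun l hl ε hε =>
    exists_graph_alphaRadius_near h0.le h1 (h2 l hl) (hF0 l hl) (hF1 l hl).le hε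

theorem alpha_zero_case : IsTau0 0 √(2 + √5) ∧
    {l : ℝ | 2 < l ∧ funF1 0 l = 0} = {√(2 + √5)} ∧
    (∀ l ∈ Set.Ioi √(2 + √5), funF1 0 l < 0) ∧
    ∀ l ∈ Set.Ici √(2 + √5), IsAlphaLimitPoint 0 l := by
  obtain ⟨b, hb, hb1, hq, hp⟩ := exists_root_alpha_zero
  rw [← hp]
  have h2 : ∀ l ∈ Set.Ioi (paramOfRoot 0 b), 2 < l :=
    fun l hl => (paramOfRoot_gt_two hb hb1).trans hl
  have hF1 : ∀ l ∈ Set.Ioi (paramOfRoot 0 b), funF1 0 l < 0 := fun l hl =>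
    funF1_neg le_rfl zero_lt_one (h2 l hl)
      (cubicDelta_zero_pos (negTheta_spec zero_lt_one (h2 l hl)).1)
      (funF0_neg le_rfl hb hb1 hq hl)
  refine ⟨isTau0_paramOfRoot le_rfl hb hb1 hq, setOf_funF1_zero hb hb1 hq, hF1, fun l hl => ?_⟩
  refine isAlphaLimitPoint_of_Ioo (t := paramOfRoot 0 b) (t' := l + 1)
    (fun m hm ε hε => ?_) l ⟨hl, by linarith⟩
  exact exists_graph_alphaRadius_near le_rfl zero_lt_one (h2 m hm.1)
    (funF0_neg le_rfl hb hb1 hq hm.1) (hF1 m hm.1).le hε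

theorem theorem5p1 :
    -- the case `0 < α < α*`
    (∀ α : ℝ, 0 < α → α < alphaStar →
      ∃ t t' : ℝ, IsTau1Pair α t t' ∧
        (∀ l ∈ Set.Ioo t t', funF1 α l < 0) ∧
        (∀ l ∈ Set.Ico t t', IsAlphaLimitPoint α l)) ∧
    -- the case `α = 0`, where `τ₁(0) = √(2 + √5)` and `τ₁'(0) = ∞`
    (IsTau0 0 √(2 + √5) ∧
      {l : ℝ | 2 < l ∧ funF1 0 l = 0} = {√(2 + √5)} ∧
      (∀ l ∈ Set.Ioi √(2 + √5), funF1 0 l < 0) ∧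
      (∀ l ∈ Set.Ici √(2 + √5), IsAlphaLimitPoint 0 l)) ∧
    -- at `α*` the two solutions coincide
    (∃ t : ℝ, IsTau0 alphaStar t ∧ {l : ℝ | 2 < l ∧ funF1 alphaStar l = 0} = {t}) ∧
    -- `α*` is the largest number below which the interval `(τ₁(α), τ₁'(α))` exists and `F₁ < 0` on it
    IsGreatest
      {β : ℝ | 0 < β ∧ β ≤ 1 ∧ ∀ α : ℝ, 0 < α → α < β →
        ∃ t t' : ℝ, IsTau1Pair α t t' ∧ ∀ l ∈ Set.Ioo t t', funF1 α l < 0}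
      alphaStar := by
  refine ⟨fun α h0 h => exists_tau1Pair h0 h, alpha_zero_case, exists_tau_alphaStar,
    ⟨alphaStar_pos, alphaStar_lt_one.le, fun α h0 h => ?_⟩, ?_⟩
  · obtain ⟨t, t', hp, hneg, -⟩ := exists_tau1Pair h0 h
    exact ⟨t, t', hp, hneg⟩
  · rintro β ⟨-, -, hβ⟩
    -- A larger β would have to allow α = α*, where F₁ has only one zero, so no pair t < t' exists.
    by_contra! hlt
    obtain ⟨t, t', ⟨-, htt, hset⟩, -⟩ := hβ alphaStar alphaStar_pos hlt
    obtain ⟨s, -, hs⟩ := exists_tau_alphaStar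
    rw [hs] at hset
    have h1 : t ∈ ({s} : Set ℝ) := by simp [hset]
    have h2 : t' ∈ ({s} : Set ℝ) := by simp [hset]
    rw [Set.mem_singleton_iff] at h1 h2
    linarith
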